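/- Let $(K;+,\cdot,D)$ be a differential field of characteristic zero with field of constants $C$. For $x\in K\setminus C$ let $\partial_x=(Dx)^{-1}D$. Let $n\ge 1$, let $c_0,\dots,c_{n-1}\in C$ with $c_0\neq 0$, and put $$\Delta(x,y)=(Dx)^{2n-1}\left[\partial_x^n y+c_{n-1}\partial_x^{n-1}y+\dots+c_1\partial_x y+c_0y\right],\qquad p(\lambda)=\lambda^n+c_{n-1}\lambda^{n-1}+\dots+c_0 .$$ Let $m\ge 1$ and let $(x_1,y_1),\dots,(x_m,y_m)\in K^2$ satisfy $\Delta(x_j,y_j)=0$ and $x_j\in K\setminus C$ for all $j$. Let $L$ be any differential field extension of $K$ (with field of constants $C_L$) over which $p$ splits and in which each equation $\Delta(x_j,\cdot)=0$ has a canonical fundamental system of solutions (for example a differential closure of $K$, or $K$ itself if $K$ is differentially closed). Let $\mu_1,\dots,\mu_k\in L$ be the distinct roots of $p$, with multiplicities $n_1,\dots,n_k$. A canonical fundamental system at $x\in L\setminus C_L$ is a family $v_{it}=a_{it}\,x^t w_i$ ($1\le i\le k$, $0\le t<n_i$), where $w_i\in L^\times$, $\partial_x w_i=\mu_i w_i$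 and $a_{it}\in C_L^\times$. Fix such a system for each $x_j$. Then $y_j$ is uniquely of the form $\sum_{i,t}b_{it}v_{it}$ with $b_{it}\in C_L$. Set $\epsilon_i(y_j)=1$ if $b_{it}\ne 0$ for some $t$, and $\epsilon_i(y_j)=0$ otherwise, and put $\epsilon(y_j)x_j=(\epsilon_1(y_j)\mu_1x_j,\dots,\epsilon_k(y_j)\mu_kx_j)$. Then $$\operatorname{td}_C C(\bar x,\bar y,\partial_{\bar x}\bar y,\dots,\partial_{\bar x}^{n-1}\bar y)-\operatorname{ldim}_{\mathbb Q}(\epsilon(y_1)x_1,\dots,\epsilon(y_m)x_m/C)\ \ge\ 1,$$ where $\partial^l_{\bar x}\bar y=(\partial_{x_1}^l y_1,\dots,\partial_{x_m}^l y_m)$, $\operatorname{td}$ is transcendence degree, and $\operatorname{ldim}_{\mathbb Q}(\,\cdot\,/C)$ is the dimension of the $\mathbb Q$-linear span of the given elements in the quotient space $L/C_L$ (which is $K/C$ when $L=K$). -/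

import Mathlib

open scoped Differential

namespace ConstCoeffLDE

/-- The field of constants `C = {a : a′ = 0}` of a differential field `K`. -/
def constants (K : Type*) [Field K] [Differential K] : Subfield K where
  carrier := {a | a′ = 0}
  mul_mem' {a b} ha hb := by
    simp only [Set.mem_ofPred_eq] at ha hb ⊢
    simp [Derivation.leibniz, ha, hb]
  one_mem' := by simp
  add_mem' {a b} ha hb := by
    simp only [Set.mem_ofPred_eq] at ha hb ⊢
    simp [ha, hb]
  zero_mem' := by simp
  neg_mem' {a} ha := by
    simp only [Set.mem_ofPred_eq] at ha ⊢
    simp [ha]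
  inv_mem' a ha := by
    simp only [Set.mem_ofPred_eq] at ha ⊢
    rw [Derivation.leibniz_inv, ha, smul_zero]

/-- The field of constants as a `ℚ`-linear subspace (characteristic zero). -/
def constantsQ (K : Type*) [Field K] [CharZero K] [Differential K] : Submodule ℚ K where
  carrier := constants K
  add_mem' ha hb := (constants K).add_mem ha hb
  zero_mem' := (constants K).zero_mem
  smul_mem' q a ha := by
    rw [Rat.smul_def]
    exact (constants K).mul_mem (SubfieldClass.ratCast_mem (constants K) q) ha

/-- The derivation `∂ₓ = (x′)⁻¹ · ′` of `K` (meaningful when `x` is non-constant). -/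
noncomputable def pd {K : Type*} [Field K] [Differential K] (x : K) : Derivation ℤ K K :=
  (x′)⁻¹ • Differential.deriv

/-- `Δ(x, y) = (x′)²ⁿ⁻¹ (∂ₓⁿ y + cₙ₋₁ ∂ₓⁿ⁻¹ y + ⋯ + c₁ ∂ₓ y + c₀ y)`, for `x` non-constant. -/
noncomputable def Delta {K : Type*} [Field K] [Differential K] {n : ℕ} (c : Fin n → K)
    (x y : K) : K :=
  (x′) ^ (2 * n - 1) * ((pd x)^[n] y + ∑ i : Fin n, c i * (pd x)^[(i : ℕ)] y)

/-- The characteristic polynomial `p(λ) = λⁿ + cₙ₋₁ λⁿ⁻¹ + ⋯ + c₀`. -/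
noncomputable def charPoly {K : Type*} [Field K] {n : ℕ} (c : Fin n → K) : Polynomial K :=
  Polynomial.X ^ n + ∑ i : Fin n, Polynomial.C (c i) * Polynomial.X ^ (i : ℕ)

/-- `μ₁, …, μₖ` are all the distinct roots, in the extension field `L` of `K`, of the
characteristic polynomial, which splits over `L`, and `ν₁, …, νₖ` are their multiplicities. -/
structure IsEigenvalues {K L : Type*} [Field K] [Field L] [Algebra K L] {n k : ℕ}
    (c : Fin n → K) (μ : Fin k → L) (ν : Fin k → ℕ) : Prop where
  injective : Function.Injective μ
  mult_pos : ∀ i, 0 < ν i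
  factor : (charPoly c).map (algebraMap K L) =
    ∏ i, (Polynomial.X - Polynomial.C (μ i)) ^ ν i

/-- `v` is a canonical fundamental system at `x`, for the eigenvalues `μ` with multiplicities `ν`.
Its members are indexed by pairs `⟨i, j⟩` with `i : Fin k` (the block) and `j < νᵢ`:
`v ⟨i, j⟩ = aᵢⱼ xʲ wᵢ`, where `wᵢ ≠ 0`, `∂ₓ wᵢ = μᵢ wᵢ` and the `aᵢⱼ` are non-zero constants. -/
def IsCanonicalSystem {L : Type*} [Field L] [Differential L] {k : ℕ} (μ : Fin k → L)
    (ν : Fin k → ℕ) (x : L) (v : (Σ i : Fin k, Fin (ν i)) → L) : Prop :=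
  ∃ (w : Fin k → L) (a : (Σ i : Fin k, Fin (ν i)) → L),
    (∀ i, w i ≠ 0 ∧ pd x (w i) = μ i * w i) ∧
    (∀ s, a s ∈ constants L ∧ a s ≠ 0) ∧
    ∀ s, v s = a s * x ^ (s.2 : ℕ) * w s.1

open Classical in
/-- `εᵢ(y)`, relative to a canonical fundamental system `v`: it is `1` if, in the (unique)
representation `y = ∑ₛ bₛ vₛ` with constant coefficients, some coefficient in the `i`-th block is
non-zero, and `0` otherwise. -/
noncomputable def eps {L : Type*} [Field L] [Differential L] {k : ℕ} {ν : Fin k → ℕ}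
    (v : (Σ i : Fin k, Fin (ν i)) → L) (y : L) (i : Fin k) : ℕ :=
  if ∃ b : (Σ i : Fin k, Fin (ν i)) → L, (∀ s, b s ∈ constants L) ∧ y = ∑ s, b s * v s ∧
      ∃ j : Fin (ν i), b ⟨i, j⟩ ≠ 0
  then 1 else 0

/-- `ldim_ℚ(u / C)`: the dimension of the `ℚ`-span of the image in `L / C` of the finite
tuple `u`. -/
noncomputable def ldim {L : Type*} [Field L] [CharZero L] [Differential L] {ι : Type*} [Finite ι]
    (u : ι → L) : ℕ :=
  Module.finrank ℚ (Submodule.span ℚ (Set.range fun i => (constantsQ L).mkQ (u i)))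

/-- `td_C C(S)`: the transcendence degree over `C` of the field generated by `S` over `C`. -/
noncomputable def td {K : Type*} [Field K] [Differential K] (S : Set K) : Cardinal :=
  Algebra.trdeg (constants K) (IntermediateField.adjoin (constants K) S)

end ConstCoeffLDE

/-! The inequality is Ax's theorem for the pairs u = μᵢxⱼ, w = wᵢ, where Dw = Du·w because μᵢ is
constant. If εᵢ(yⱼ) = 1, a constant-coefficient polynomial in ∂ₓ carries yⱼ to a nonzero constant
multiple of wᵢ (`exists_aeval_apply_eq_smul`), so a derivation killing the constants and all ∂ˡyⱼ
kills wᵢ. If εᵢ(yⱼ) = 0, the entry is zero and adds nothing to the span.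

Ax's theorem (`card_add_one_le_of_exponential`) uses differential forms, seen as functionals on
derivations over C. The forms dx and dw/w − du lie in the span of dz for a transcendence basis z, so
it suffices that they are independent. Pairing with D removes dx. Relations among the remaining
forms are stable under D, so a nontrivial one yields a nontrivial one with constant coefficients.
That makes a combination of logarithmic forms exact; by residues the functions under the logarithms
are algebraic over C (`isAlgebraic_of_sum_logDeriv_exact`), against the independence of the u modulo
constants. -/

namespace ConstCoeffLDE

open Polynomial

/-! ### The derivation d/dt, and orders and residues at t = 0 -/

section Derivations

variable {C L : Type*} [Field C] [Field L] [Algebra C L]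

theorem derivation_eq_zero_of_isAlgebraic [CharZero C] (E : Derivation C L L) {z : L}
    (hz : IsAlgebraic C z) : E z = 0 := by
  have h := E.map_aeval (minpoly C z) z
  rw [minpoly.aeval, map_zero] at h
  refine (smul_eq_zero.mp h.symm).resolve_left ?_
  exact (minpoly.irreducible hz.isIntegral).separable.aeval_derivative_ne_zero (minpoly.aeval C z)

/-- If `t` is transcendental over `C` and `L` is algebraic over `C(t)`, then `d/dt` exists on `L`. -/
theorem exists_derivation [CharZero C] {t : L} (ht : Transcendental C t)
    [Algebra.IsAlgebraic (IntermediateField.adjoin C {t}) L] :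
    ∃ E : Derivation C L L, E t = 1 := by
  let : Algebra C[X] L := (aeval t : C[X] →ₐ[C] L).toAlgebra
  have : IsScalarTower C C[X] L := IsScalarTower.of_algebraMap_eq' (by
    ext c; simp [RingHom.algebraMap_toAlgebra])
  have hinj : Function.Injective (algebraMap C[X] L) := by
    rw [RingHom.algebraMap_toAlgebra]
    exact transcendental_iff_injective.mp ht
  have : FaithfulSMul C[X] L := (faithfulSMul_iff_algebraMap_injective _ _).mpr hinj
  let : Algebra (FractionRing C[X]) L := FractionRing.liftAlgebra C[X] L
  have : IsScalarTower C[X] (FractionRing C[X]) L := FractionRing.isScalarTower_liftAlgebra C[X] L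
  have halg : Algebra.IsAlgebraic C[X] L := by
    have := IntermediateField.isAlgebraic_adjoin_iff_top.mp
      (inferInstance : Algebra.IsAlgebraic (IntermediateField.adjoin C {t}) L)
    let f : C[X] →ₐ[C] Algebra.adjoin C {t} := aeval ⟨t, Algebra.self_mem_adjoin_singleton C t⟩
    have hf (p : C[X]) : (f p : L) = aeval t p := by
      simp [f, Polynomial.aeval_subalgebra_coe]
    refine ⟨fun z => (Algebra.IsAlgebraic.isAlgebraic (R := Algebra.adjoin C {t})
      z).of_ringHom_of_comp_eq f (RingHom.id L) ?_ Function.injective_id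
      (RingHom.ext fun p => hf p)⟩
    rintro ⟨z, hz⟩
    obtain ⟨p, rfl⟩ := (Algebra.adjoin_singleton_eq_range_aeval C t) ▸ hz
    exact ⟨p, Subtype.ext (hf p)⟩
  have : Algebra.IsAlgebraic (FractionRing C[X]) L :=
    (IsFractionRing.comap_isAlgebraic_iff (A := C[X])).mp halg
  have : CharZero (FractionRing C[X]) := inferInstance
  have : Algebra.FormallyEtale (FractionRing C[X]) L := Algebra.FormallyEtale.of_isSeparable _ _
  have : Algebra.FormallyEtale C[X] (FractionRing C[X]) :=
    Algebra.FormallyEtale.of_isLocalization (nonZeroDivisors C[X])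
  have : Algebra.FormallyEtale C[X] L := Algebra.FormallyEtale.comp _ (FractionRing C[X]) _
  let d : Derivation C C[X] L := Polynomial.mkDerivation C (1 : L)
  let f := (d.liftKaehlerDifferential).liftBaseChange L ∘ₗ
    (KaehlerDifferential.tensorKaehlerEquivOfFormallyEtale C C[X] L).symm.toLinearMap
  refine ⟨f.compDer (KaehlerDifferential.D C L), ?_⟩
  have h1 : t = algebraMap C[X] L X := by simp [RingHom.algebraMap_toAlgebra]
  rw [Derivation.coe_comp]
  simp only [LinearMap.coe_comp, Function.comp_apply, f, LinearMap.coe_restrictScalars,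
    Derivation.coeFn_coe]
  rw [h1]
  erw [KaehlerDifferential.tensorKaehlerEquivOfFormallyEtale_symm_D_algebraMap C C[X] L X]
  simp [d]

/-- `z` is a rational function of `t`, regular at `t = 0` with value `c`. -/
def HasValue (t z : L) (c : C) : Prop :=
  ∃ p q : C[X], q.eval 0 ≠ 0 ∧ p.eval 0 = c * q.eval 0 ∧ z * aeval t q = aeval t p

variable {t : L}

theorem aeval_ne_zero_of_eval (ht : Transcendental C t) {q : C[X]} (hq : q.eval 0 ≠ 0) :
    aeval t q ≠ 0 := by
  intro h
  rw [(transcendental_iff.mp ht) q h] at hq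
  simp at hq

theorem HasValue.unique (ht : Transcendental C t) {z : L} {c d : C}
    (hc : HasValue t z c) (hd : HasValue t z d) : c = d := by
  obtain ⟨p, q, hq, hpq, h⟩ := hc
  obtain ⟨p', q', hq', hpq', h'⟩ := hd
  have h2 : p * q' - p' * q = 0 := by
    refine transcendental_iff.mp ht _ ?_
    rw [map_sub, map_mul, map_mul, ← h, ← h']
    ring
  have h3 := congrArg (eval 0) h2
  simp only [eval_sub, eval_mul, eval_zero, hpq, hpq'] at h3
  have : (c - d) * (q.eval 0 * q'.eval 0) = 0 := by linear_combination h3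
  exact sub_eq_zero.mp ((mul_eq_zero.mp this).resolve_right (mul_ne_zero hq hq'))

theorem HasValue.add {z z' : L} {c c' : C} (h : HasValue t z c) (h' : HasValue t z' c') :
    HasValue t (z + z') (c + c') := by
  obtain ⟨p, q, hq, hpq, h⟩ := h
  obtain ⟨p', q', hq', hpq', h'⟩ := h'
  refine ⟨p * q' + p' * q, q * q', by simp [hq, hq'], ?_, ?_⟩
  · simp only [eval_add, eval_mul, hpq, hpq']; ring
  · simp only [map_add, map_mul, ← h, ← h']; ring

theorem HasValue.mul {z z' : L} {c c' : C} (h : HasValue t z c) (h' : HasValue t z' c') :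
    HasValue t (z * z') (c * c') := by
  obtain ⟨p, q, hq, hpq, h⟩ := h
  obtain ⟨p', q', hq', hpq', h'⟩ := h'
  refine ⟨p * p', q * q', by simp [hq, hq'], ?_, ?_⟩
  · simp only [eval_mul, hpq, hpq']; ring
  · simp only [map_mul, ← h, ← h']; ring

theorem HasValue.inv {z : L} {c : C} (h : HasValue t z c) (hz : z ≠ 0) (hc : c ≠ 0) :
    HasValue t z⁻¹ c⁻¹ := by
  obtain ⟨p, q, hq, hpq, h⟩ := h
  refine ⟨q, p, by simp [hpq, hc, hq], by rw [hpq, inv_mul_cancel_left₀ hc], ?_⟩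
  rw [← h, inv_mul_cancel_left₀ hz]

theorem hasValue_algebraMap (c : C) : HasValue t (algebraMap C L c) c :=
  ⟨Polynomial.C c, 1, by simp, by simp, by simp⟩

theorem hasValue_self : HasValue t t (0 : C) :=
  ⟨X, 1, by simp, by simp, by simp⟩

theorem HasValue.pow {z : L} {c : C} (h : HasValue t z c) (n : ℕ) : HasValue t (z ^ n) (c ^ n) := by
  induction n with
  | zero => simpa using hasValue_algebraMap (t := t) (L := L) (1 : C)
  | succ n ih => simpa [pow_succ] using ih.mul h

theorem HasValue.sum {ι : Type*} (s : Finset ι) {z : ι → L} {c : ι → C}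
    (h : ∀ i ∈ s, HasValue t (z i) (c i)) : HasValue t (∑ i ∈ s, z i) (∑ i ∈ s, c i) := by
  classical
  induction s using Finset.induction_on with
  | empty => simpa using hasValue_algebraMap (t := t) (L := L) (0 : C)
  | insert a s ha ih =>
    rw [Finset.sum_insert ha, Finset.sum_insert ha]
    exact (h a (by simp)).add (ih fun i hi => h i (by simp [hi]))

theorem HasValue.derivation (ht : Transcendental C t) (E : Derivation C L L) (hE : E t = 1) {z : L}
    {c : C} (h : HasValue t z c) : ∃ d : C, HasValue t (E z) d := by
  obtain ⟨p, q, hq, hpq, h⟩ := h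
  have hq0 := aeval_ne_zero_of_eval ht hq
  refine ⟨_, derivative p * q - p * derivative q, q ^ 2, by simp [hq],
    (div_mul_cancel₀ _ (by simp [hq])).symm, ?_⟩
  have h2 := congrArg E h
  rw [Derivation.leibniz, E.map_aeval, E.map_aeval, hE] at h2
  simp only [smul_eq_mul, mul_one] at h2
  simp only [map_sub, map_mul, map_pow]
  linear_combination (aeval t q) * h2 - aeval t (derivative q) * h

theorem exists_zpow_mul_hasValue (ht : Transcendental C t) {g : L}
    (hg : g ∈ IntermediateField.adjoin C {t}) (hg0 : g ≠ 0) :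
    ∃ (m : ℤ) (u : L) (a : C), a ≠ 0 ∧ u ≠ 0 ∧ HasValue t u a ∧ g = t ^ m * u := by
  have ht0 : t ≠ 0 := fun h => ht (h ▸ isAlgebraic_zero)
  have key (p : C[X]) (hp : p ≠ 0) :
      ∃ (n : ℕ) (r : C[X]), r.eval 0 ≠ 0 ∧ aeval t p = t ^ n * aeval t r := by
    obtain ⟨r, hr, hr'⟩ := Polynomial.exists_eq_pow_rootMultiplicity_mul_and_not_dvd p hp 0
    refine ⟨p.rootMultiplicity 0, r, ?_, by simpa using congrArg (aeval t) hr⟩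
    rwa [dvd_iff_isRoot] at hr'
  obtain ⟨p, q, rfl⟩ := (IntermediateField.mem_adjoin_simple_iff C g).mp hg
  have hp : p ≠ 0 := by rintro rfl; simp at hg0
  have hq : q ≠ 0 := by rintro rfl; simp at hg0
  obtain ⟨n, r, hr, h1⟩ := key p hp
  obtain ⟨n', r', hr', h1'⟩ := key q hq
  have hr0 := aeval_ne_zero_of_eval ht hr
  have hr0' := aeval_ne_zero_of_eval ht hr'
  refine ⟨n - n', aeval t r / aeval t r', r.eval 0 / r'.eval 0, div_ne_zero hr hr',
    div_ne_zero hr0 hr0', ⟨r, r', hr', by field_simp, by field_simp⟩, ?_⟩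
  rw [h1, h1', zpow_sub₀ ht0]
  simp
  field_simp

/-- The residue of dg/g is the order m of g: for g = tᵐu, the product t·g′/g equals m + t·u′/u. -/
theorem exists_hasValue_logDeriv (ht : Transcendental C t) (E : Derivation C L L) (hE : E t = 1)
    {m : ℤ} {u : L} {a : C} (ha : a ≠ 0) (hu0 : u ≠ 0) (hu : HasValue t u a) :
    HasValue t (t * (E (t ^ m * u) / (t ^ m * u))) (m : C) := by
  have ht0 : t ≠ 0 := fun h => ht (h ▸ isAlgebraic_zero)
  obtain ⟨d, hd⟩ := hu.derivation ht E hE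
  have h := (hasValue_algebraMap (t := t) (L := L) (m : C)).add
    (hasValue_self.mul (hd.mul (hu.inv hu0 ha)))
  convert h using 1
  · rw [Derivation.leibniz, Derivation.leibniz_zpow, hE]
    simp only [smul_eq_mul, zsmul_eq_mul, map_intCast]
    rw [zpow_sub_one₀ ht0]
    field_simp
    ring
  · ring

/-- An exact form dH has no residue: for H = tᵐu, t·H′ = tᵐ(mu + tu′), which vanishes at 0 if m ≥ 0
and has a genuine pole if m < 0. -/
theorem value_mul_derivation_eq_zero [CharZero C] (ht : Transcendental C t) (E : Derivation C L L)
    (hE : E t = 1) {H : L} (hH : H ∈ IntermediateField.adjoin C {t}) {c : C}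
    (hc : HasValue t (t * E H) c) : c = 0 := by
  have ht0 : t ≠ 0 := fun h => ht (h ▸ isAlgebraic_zero)
  by_cases hH0 : H = 0
  · subst hH0
    simp only [map_zero, mul_zero] at hc
    exact hc.unique ht (by simpa using hasValue_algebraMap (t := t) (L := L) (0 : C))
  obtain ⟨m, u, a, ha, hu0, hu, rfl⟩ := exists_zpow_mul_hasValue ht hH hH0
  obtain ⟨d, hd⟩ := hu.derivation ht E hE
  have h1 := ((hasValue_algebraMap (t := t) (L := L) (m : C)).mul hu).add (hasValue_self.mul hd)
  have h2 : t * E (t ^ m * u) = t ^ m * (algebraMap C L m * u + t * E u) := by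
    rw [Derivation.leibniz, Derivation.leibniz_zpow, hE]
    simp only [smul_eq_mul, zsmul_eq_mul, map_intCast]
    rw [zpow_sub_one₀ ht0]
    field_simp
    ring
  rw [h2] at hc
  obtain ⟨k, rfl | rfl⟩ := m.eq_nat_or_neg
  · have h3 := (hasValue_self.pow k).mul h1
    rw [zpow_natCast] at hc
    rw [hc.unique ht h3]
    rcases k with _ | k <;> simp
  · have h3 := (hasValue_self.pow k).mul hc
    rw [zpow_neg, zpow_natCast, mul_inv_cancel_left₀ (pow_ne_zero k ht0)] at h3
    have h4 := h1.unique ht h3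
    rcases k with _ | k
    · simpa using h4.symm
    · rw [zero_mul, add_zero, pow_succ, mul_zero, zero_mul] at h4
      have h5 := Int.cast_eq_zero.mp ((mul_eq_zero.mp h4).resolve_right ha)
      omega

end Derivations

/-! ### Descent along algebraic extensions by norm and trace -/

section Descent

open Differential

variable {F N : Type*} [Field F] [Field N] [CharZero F] [Differential F] [Differential N]
  [Algebra F N] [DifferentialAlgebra F N] {ι : Type*} [Fintype ι]

/-- Sum the Galois conjugates of the relation: the group commutes with the derivation and fixes the
`e i`. -/
theorem sum_logDeriv_norm [FiniteDimensional F N] [IsGalois F N] (e : ι → F) (W : ι → N)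
    (hW : ∀ i, W i ≠ 0) (h : N) (H : ∑ i, algebraMap F N (e i) * Differential.logDeriv (W i) = h′) :
    ∑ i, e i * Differential.logDeriv (Algebra.norm F (W i)) = (Algebra.trace F N h)′ := by
  apply FaithfulSMul.algebraMap_injective F N
  have hσ (σ : N ≃ₐ[F] N) : ∑ i, algebraMap F N (e i) * Differential.logDeriv (σ (W i)) = (σ h)′ := by
    rw [← algEquiv_deriv', ← H, map_sum]
    refine Finset.sum_congr rfl fun i _ => ?_
    rw [map_mul, σ.commutes, Differential.logDeriv, Differential.logDeriv, map_div₀, algEquiv_deriv']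
  rw [← deriv_algebraMap, trace_eq_sum_automorphisms, map_sum, map_sum]
  simp_rw [map_mul, ← Differential.logDeriv_algebraMap, Algebra.norm_eq_prod_automorphisms]
  rw [← Finset.sum_congr rfl fun σ _ => hσ σ, Finset.sum_comm]
  refine Finset.sum_congr rfl fun i _ => ?_
  rw [Differential.logDeriv_prod _ _ _ fun σ _ => by simpa using hW i, Finset.mul_sum]

/-- Only finitely many elements occur, so a finite normal closure suffices. The last clause holds
because the norm of an element of the base is a power; it keeps track of the order of t. -/
theorem exists_sum_logDeriv [Algebra.IsAlgebraic F N] (e : ι → F) (W : ι → N)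
    (hW : ∀ i, W i ≠ 0) (h : N) (H : ∑ i, algebraMap F N (e i) * Differential.logDeriv (W i) = h′) :
    ∃ (n : ℕ) (g : ι → F) (v : F), n ≠ 0 ∧ (∀ i, g i ≠ 0) ∧ ∑ i, e i * Differential.logDeriv (g i) = v′ ∧
      ∀ i z, W i = algebraMap F N z → g i = z ^ n := by
  let B := IntermediateField.adjoin F (insert h (Set.range W))
  have : FiniteDimensional F B := IntermediateField.finiteDimensional_adjoin
    fun x _ => Algebra.IsIntegral.isIntegral x
  let φ : B →ₐ[F] AlgebraicClosure F := IsAlgClosed.lift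
  let M := IntermediateField.normalClosure F φ.fieldRange (AlgebraicClosure F)
  have : FiniteDimensional F φ.fieldRange := LinearMap.finiteDimensional_range φ.toLinearMap
  let ψ : B →ₐ[F] M := (IntermediateField.inclusion
    (IntermediateField.le_normalClosure φ.fieldRange)).comp φ.rangeRestrict
  have hB (z : B) : ((z′ : B) : N) = (z : N)′ := (deriv_algebraMap (B := N) z).symm
  let W' (i : ι) : B := ⟨W i, IntermediateField.subset_adjoin _ _ (by simp)⟩
  let h' : B := ⟨h, IntermediateField.subset_adjoin _ _ (by simp)⟩
  have H' : ∑ i, algebraMap F B (e i) * Differential.logDeriv (W' i) = h'′ := by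
    apply Subtype.val_injective
    rw [hB, ← H]
    simp [Differential.logDeriv, hB, W']
  have H'' : ∑ i, algebraMap F M (e i) * Differential.logDeriv (ψ (W' i)) = (ψ h')′ := by
    rw [← algHom_deriv' ψ ψ.injective, ← H', map_sum]
    refine Finset.sum_congr rfl fun i _ => ?_
    rw [map_mul, ψ.commutes, Differential.logDeriv, Differential.logDeriv, map_div₀, algHom_deriv' ψ ψ.injective]
  have hW' (i : ι) : ψ (W' i) ≠ 0 := by
    rw [_root_.map_ne_zero]
    exact fun h0 => hW i (congrArg Subtype.val h0)
  refine ⟨Module.finrank F M, _, _, Module.finrank_pos.ne', fun i => ?_,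
    sum_logDeriv_norm e _ hW' _ H'', fun i z hz => ?_⟩
  · exact Algebra.norm_ne_zero_iff.mpr (hW' i)
  · have : W' i = algebraMap F B z := Subtype.val_injective hz
    rw [this, ψ.commutes, Algebra.norm_algebraMap]

end Descent

/-! ### Exact combinations of logarithmic forms -/

section Residue

variable {C L : Type*} [Field C] [Field L] [Algebra C L] {t : L} {ι : Type*} [Fintype ι]

/-- Descend to C(t) and take residues at 0. The exact side gives 0, each term gives `e i` times an
integer, and t itself descends to tⁿ with n ≠ 0. -/
theorem exists_residue_relation [CharZero C] (ht : Transcendental C t)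
    [Algebra.IsAlgebraic (IntermediateField.adjoin C {t}) L] (E : Derivation C L L) (hE : E t = 1)
    (e : ι → C) (W : ι → L) (hW : ∀ i, W i ≠ 0) (h : L)
    (H : ∑ i, algebraMap C L (e i) * (E (W i) / W i) = E h) (i₀ : ι) (hi₀ : W i₀ = t) :
    ∃ m : ι → ℤ, m i₀ ≠ 0 ∧ ∑ i, e i * m i = 0 := by
  have ht0 : t ≠ 0 := fun h => ht (h ▸ isAlgebraic_zero)
  let F := IntermediateField.adjoin C {t}
  have hEF (z : L) (hz : z ∈ F) : E z ∈ F := by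
    obtain ⟨p, q, rfl⟩ := (IntermediateField.mem_adjoin_simple_iff C z).mp hz
    have hF (r : C[X]) : aeval t r ∈ F :=
      by
      have h := (aeval (⟨t, IntermediateField.mem_adjoin_simple_self C t⟩ : F) r).2
      rwa [← IntermediateField.aeval_coe] at h
    rw [Derivation.leibniz_div, E.map_aeval, E.map_aeval, hE]
    simp only [smul_eq_mul, mul_one]
    exact F.mul_mem (pow_mem (F.inv_mem (hF _)) 2) (F.sub_mem (F.mul_mem (hF _) (hF _))
      (F.mul_mem (hF _) (hF _)))
  let : Differential L := ⟨E.restrictScalars ℤ⟩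
  let : Differential F := ⟨Derivation.mk'
    { toFun := fun z => ⟨E z, hEF z z.2⟩
      map_add' := fun a b => Subtype.ext (by simp)
      map_smul' := fun a b => Subtype.ext (by simp) }
    fun a b => Subtype.ext (by simp)⟩
  have : DifferentialAlgebra F L := ⟨fun _ => rfl⟩
  obtain ⟨n, g, v, hn, hg, hgv, hgW⟩ := exists_sum_logDeriv (F := F) (N := L)
    (fun i => algebraMap C F (e i)) W hW h H
  have hgE : ∑ i, algebraMap C L (e i) * (E (g i) / g i) = E v := by
    have := congrArg (algebraMap F L) hgv
    rw [map_sum] at this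
    exact this
  have hg' (i : ι) : ((g i : F) : L) ≠ 0 := fun h0 => hg i (Subtype.val_injective h0)
  have key (i : ι) : ∃ m : ℤ, HasValue t (t * (E (g i) / g i)) (m : C) ∧ (i = i₀ → m ≠ 0) := by
    by_cases hi : i = i₀
    · have h1 : ((g i : F) : L) = t ^ (n : ℤ) * 1 := by
        rw [hgW i ⟨t, IntermediateField.mem_adjoin_simple_self C t⟩ (by rw [hi, hi₀]; rfl)]
        simp
      refine ⟨n, ?_, fun _ => by exact_mod_cast hn⟩
      rw [h1]
      exact exists_hasValue_logDeriv ht E hE one_ne_zero one_ne_zero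
        (by simpa using hasValue_algebraMap (t := t) (L := L) (1 : C))
    · obtain ⟨m, u, a, ha, hu0, hu, hgu⟩ := exists_zpow_mul_hasValue ht (g i).2 (hg' i)
      refine ⟨m, ?_, fun h => absurd h hi⟩
      rw [hgu]
      exact exists_hasValue_logDeriv ht E hE ha hu0 hu
  choose m hm hm₀ using key
  refine ⟨m, hm₀ i₀ rfl, value_mul_derivation_eq_zero ht E hE v.2 ?_⟩
  rw [← hgE, Finset.mul_sum]
  refine HasValue.sum _ fun i _ => ?_
  rw [mul_left_comm]
  exact (hasValue_algebraMap (e i)).mul (hm i)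

theorem isAlgebraic_of_sum_logDeriv_exact [CharZero C] (e : ι → C) (he : LinearIndependent ℤ e)
    (W : ι → L) (hW : ∀ i, W i ≠ 0) (h : L)
    (H : ∀ E : Derivation C L L, ∑ i, algebraMap C L (e i) * (E (W i) / W i) = E h) (i : ι) :
    IsAlgebraic C (W i) := by
  by_contra hi
  have hind : AlgebraicIndepOn C id {W i} :=
    (algebraicIndependent_singleton_iff (⟨W i, rfl⟩ : ({W i} : Set L))).mpr hi
  obtain ⟨B, hB, hbasis⟩ := exists_isTranscendenceBasis_superset hind
  -- The other basis elements join the base field, so that `W i` can play the role of t.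
  let C' := IntermediateField.adjoin C (B \ {W i})
  have ht : Transcendental C' (W i) := by
    refine IntermediateField.transcendental_adjoin_iff.mpr ?_
    have := hbasis.1.transcendental_adjoin (s := {x | x.1 ≠ W i})
      (i := ⟨W i, hB rfl⟩) (by simp)
    rwa [show Subtype.val '' {x : B | x.1 ≠ W i} = B \ {W i} by
      ext; simp [and_comm]] at this
  have halg : Algebra.IsAlgebraic (IntermediateField.adjoin C' {W i}) L := by
    have := hbasis.isAlgebraic_field
    have hle : IntermediateField.adjoin C (Set.range (Subtype.val : B → L)) ≤
        (IntermediateField.adjoin C' {W i}).restrictScalars C := by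
      rw [IntermediateField.adjoin_adjoin_left, Subtype.range_coe, Set.sdiff_union_of_subset hB]
    exact Algebra.IsAlgebraic.ringHom_of_comp_eq (IntermediateField.inclusion hle).toRingHom
      (RingHom.id L) (IntermediateField.inclusion hle).injective Function.surjective_id rfl
  obtain ⟨E, hE⟩ := exists_derivation ht
  obtain ⟨m, hm, hsum⟩ := exists_residue_relation ht E hE (fun i => algebraMap C C' (e i)) W hW h
    (by
      have := H (E.restrictScalars C)
      exact this) i rfl
  refine hm (Fintype.linearIndependent_iff.mp he m ?_ i)
  apply (algebraMap C C').injective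
  rw [map_zero, ← hsum, map_sum]
  simp [mul_comm]

end Residue

/-! ### Ax's theorem for one derivation -/

section Ax

variable {C L : Type*} [Field C] [Field L] [Algebra C L] {ι : Type*} [Fintype ι]

/-- The value on derivations of the differential form `dw / w - du`. -/
noncomputable def logForm (C : Type*) {L : Type*} [Field C] [Field L] [Algebra C L] (u w : L) :
    Derivation C L L →ₗ[L] L where
  toFun E := E w / w - E u
  map_add' E E' := by simp; ring
  map_smul' a E := by simp; ring

/-- Evaluation of derivations at an element. -/
def evalDerivation (C : Type*) {L : Type*} [Field C] [Field L] [Algebra C L] (x : L) :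
    Derivation C L L →ₗ[L] L where
  toFun E := E x
  map_add' _ _ := rfl
  map_smul' _ _ := rfl

/-- Scale a member so that one coordinate is 1. Applying D kills that coordinate and creates no new
support, so either all coordinates were constant or the support has shrunk. -/
theorem exists_constant_mem_of_stable (D : Derivation C L L)
    (hD : ∀ a, D a = 0 → ∃ c, algebraMap C L c = a) (R : Submodule L (ι → L))
    (hR : ∀ a ∈ R, (fun i => D (a i)) ∈ R) (hne : R ≠ ⊥) :
    ∃ c : ι → C, c ≠ 0 ∧ (fun i => algebraMap C L (c i)) ∈ R := by
  classical
  obtain ⟨a, ha, ha0⟩ := Submodule.exists_mem_ne_zero_of_ne_bot hne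
  induction hn : (Finset.univ.filter fun i => a i ≠ 0).card using Nat.strong_induction_on
    generalizing a with
  | _ n ih =>
    obtain ⟨i₀, hi₀⟩ := Function.ne_iff.mp ha0
    simp only [Pi.zero_apply] at hi₀
    have hb : (a i₀)⁻¹ • a ∈ R := R.smul_mem _ ha
    by_cases hDb : (fun i => D (((a i₀)⁻¹ • a) i)) = 0
    · choose c hc using fun i => hD _ (congrFun hDb i)
      refine ⟨c, ?_, by rwa [show (fun i => algebraMap C L (c i)) = (a i₀)⁻¹ • a from funext hc]⟩
      rintro rfl
      have := hc i₀
      simp [hi₀] at this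
    · refine ih _ ?_ _ (hR _ hb) hDb rfl
      rw [← hn]
      refine Finset.card_lt_card ⟨fun i hi => ?_, fun h => ?_⟩
      · simp only [Finset.mem_filter, Finset.mem_univ, true_and] at hi ⊢
        intro h0
        simp [h0] at hi
      · have := (Finset.mem_filter.mp (h (Finset.mem_filter.mpr ⟨Finset.mem_univ i₀, hi₀⟩))).2
        rw [Pi.smul_apply, smul_eq_mul, inv_mul_cancel₀ hi₀, Derivation.map_one_eq_zero] at this
        exact this rfl

/-- The Lie derivative of ω = dw/w − du along D vanishes, since dω = 0 and ω(D) = 0. -/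
theorem logForm_commutator (D E : Derivation C L L) {u w : L} (hw0 : w ≠ 0)
    (hw : D w = D u * w) : logForm C u w ⁅D, E⁆ = D (logForm C u w E) := by
  simp only [logForm, LinearMap.coe_mk, AddHom.coe_mk, Derivation.commutator_apply, map_sub,
    hw, Derivation.leibniz, Derivation.leibniz_div, smul_eq_mul]
  field_simp
  ring

theorem derivation_prod_zpow_div (E : Derivation C L L) (w : ι → L) (hw : ∀ i, w i ≠ 0)
    (m : ι → ℤ) :
    E (∏ i, w i ^ m i) / (∏ i, w i ^ m i) = ∑ i, m i * (E (w i) / w i) := by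
  classical
  induction (Finset.univ : Finset ι) using Finset.induction_on with
  | empty => simp
  | insert a s ha ih =>
    have h0 : ∏ i ∈ s, w i ^ m i ≠ 0 := Finset.prod_ne_zero_iff.mpr fun i _ => zpow_ne_zero _ (hw i)
    have ha0 := hw a
    have ha1 := zpow_ne_zero (m a) ha0
    rw [Finset.prod_insert ha, Finset.sum_insert ha, ← ih, Derivation.leibniz,
      Derivation.leibniz_zpow]
    simp only [smul_eq_mul, zsmul_eq_mul]
    rw [zpow_sub_one₀ ha0]
    field_simp
    ring

theorem eq_zero_of_sum_logForm_eq_zero [CharZero C] (D : Derivation C L L)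
    (u w : ι → L) (hw0 : ∀ i, w i ≠ 0) (hw : ∀ i, D (w i) = D (u i) * w i)
    (hu : ∀ m : ι → ℤ, D (∑ i, m i * u i) = 0 → m = 0) (c : ι → C)
    (H : ∀ E : Derivation C L L, ∑ i, algebraMap C L (c i) * logForm C (u i) (w i) E = 0) :
    c = 0 := by
  -- A ℤ-basis of the span of the `c i` groups the w into monomials `W k` whose logarithmic forms
  -- have ℤ-independent coefficients.
  let S : Submodule ℤ C := Submodule.span ℤ (Set.range c)
  have : Module.Finite ℤ S := Module.Finite.span_of_finite ℤ (Set.finite_range c)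
  have : Module.Free ℤ S := inferInstance
  let b := Module.Free.chooseBasis ℤ S
  let c' (i : ι) : S := ⟨c i, Submodule.subset_span ⟨i, rfl⟩⟩
  have hc (i : ι) : c i = ∑ k, (b k : C) * (b.repr (c' i) k : C) := by
    have := congrArg Subtype.val (b.sum_repr (c' i))
    simp only [Submodule.coe_sum, Submodule.coe_smul, zsmul_eq_mul] at this
    exact this.symm.trans (Finset.sum_congr rfl fun _ _ => mul_comm _ _)
  let W (k) : L := ∏ i, w i ^ b.repr (c' i) k
  have hW0 (k) : W k ≠ 0 := Finset.prod_ne_zero_iff.mpr fun i _ => zpow_ne_zero _ (hw0 i)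
  have hlin : LinearIndependent ℤ fun k => (b k : C) :=
    b.linearIndependent.map' S.subtype S.ker_subtype
  have halg := isAlgebraic_of_sum_logDeriv_exact _ hlin W hW0
    (∑ i, algebraMap C L (c i) * u i) fun E => by
      have h := H E
      simp only [logForm, LinearMap.coe_mk, AddHom.coe_mk, mul_sub, Finset.sum_sub_distrib] at h
      rw [sub_eq_zero] at h
      simp only [map_sum, Derivation.leibniz, Derivation.map_algebraMap, smul_eq_mul, mul_zero,
        add_zero, W]
      rw [← h]
      simp_rw [derivation_prod_zpow_div E w hw0, Finset.mul_sum]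
      rw [Finset.sum_comm]
      refine Finset.sum_congr rfl fun i _ => ?_
      conv_rhs => rw [hc i]
      rw [map_sum, Finset.sum_mul]
      refine Finset.sum_congr rfl fun k _ => ?_
      simp [mul_assoc]
  have hm (k) : (fun i => b.repr (c' i) k) = 0 := by
    apply hu
    -- DW/W is D of the integer combination of the u with the same exponents, and DW = 0.
    have h1 := derivation_prod_zpow_div D w hw0 fun i => b.repr (c' i) k
    rw [derivation_eq_zero_of_isAlgebraic D (halg k), zero_div] at h1
    rw [map_sum, h1]
    refine Finset.sum_congr rfl fun i _ => ?_
    rw [hw, mul_div_cancel_right₀ _ (hw0 i)]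
    simp [Derivation.leibniz]
  funext i
  rw [hc i]
  exact Finset.sum_eq_zero fun k _ => by simp [congrFun (hm k) i]

/-- Ax's theorem for one derivation `D` with field of constants `C`: if `Dw = Du · w` and the `u` are
linearly independent over the integers modulo constants, then the transcendence degree of `(u, w)`
is larger than their number. -/
theorem card_add_one_le_of_exponential [CharZero C] (D : Derivation C L L)
    (hD : ∀ a, D a = 0 → ∃ c, algebraMap C L c = a)
    (u w : ι → L) (hw0 : ∀ i, w i ≠ 0) (hw : ∀ i, D (w i) = D (u i) * w i)
    (hu : ∀ m : ι → ℤ, D (∑ i, m i * u i) = 0 → m = 0) {x : L} (hx : D x ≠ 0)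
    {κ : Type*} [Fintype κ] (z : κ → L)
    (hz : ∀ E : Derivation C L L, (∀ k, E (z k) = 0) →
      (∀ i, E (u i) = 0 ∧ E (w i) = 0) ∧ E x = 0) :
    Fintype.card ι + 1 ≤ Fintype.card κ := by
  let f (o : Option ι) : Derivation C L L →ₗ[L] L :=
    o.elim (evalDerivation C x) fun i => logForm C (u i) (w i)
  have hlogD (i : ι) : logForm C (u i) (w i) D = 0 := by
    simp [logForm, hw, hw0]
  have hind : LinearIndependent L f := by
    rw [Fintype.linearIndependent_iff]
    intro g hg
    have hg' (E : Derivation C L L) :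
        g none * E x + ∑ i, g (some i) * logForm C (u i) (w i) E = 0 := by
      have := LinearMap.congr_fun hg E
      simpa [Fintype.sum_option, f, evalDerivation] using this
    have hnone : g none = 0 := by
      have := hg' D
      simp only [hlogD, mul_zero, Finset.sum_const_zero, add_zero] at this
      exact (mul_eq_zero.mp this).resolve_right hx
    let R : Submodule L (ι → L) :=
      LinearMap.ker (Fintype.linearCombination L fun i => logForm C (u i) (w i))
    have hR (a : ι → L) : a ∈ R ↔ ∀ E, ∑ i, a i * logForm C (u i) (w i) E = 0 := by
      rw [LinearMap.mem_ker, LinearMap.ext_iff]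
      simp [Fintype.linearCombination_apply]
    have hbot : R = ⊥ := by
      by_contra hne
      -- Stability: differentiate the relation at E and subtract the relation at [D, E].
      obtain ⟨c, hc, hcR⟩ := exists_constant_mem_of_stable D hD R (fun a ha => by
        rw [hR] at ha ⊢
        intro E
        have h1 := congrArg D (ha E)
        simp only [map_sum, map_zero, Derivation.leibniz, smul_eq_mul, Finset.sum_add_distrib] at h1
        have h2 := ha ⁅D, E⁆
        simp only [logForm_commutator D E (hw0 _) (hw _)] at h2
        rw [h2, zero_add] at h1
        rw [← h1]
        exact Finset.sum_congr rfl fun _ _ => mul_comm _ _) hne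
      exact hc (eq_zero_of_sum_logForm_eq_zero D u w hw0 hw hu c ((hR _).mp hcR))
    have hmem : (fun i => g (some i)) ∈ R := by
      rw [hR]
      intro E
      simpa [hnone] using hg' E
    rw [hbot, Submodule.mem_bot] at hmem
    rintro (_ | i)
    · exact hnone
    · exact congrFun hmem i
  -- A functional vanishing on the common kernel of finitely many functionals lies in their span.
  have hspan : Submodule.span L (Set.range f) ≤
      Submodule.span L (Set.range fun k => evalDerivation C (z k)) := by
    rw [Submodule.span_le]
    rintro _ ⟨o, rfl⟩
    refine mem_span_of_iInf_ker_le_ker fun E hE => ?_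
    have h := hz E fun k => (Submodule.mem_iInf _).mp hE k
    rcases o with _ | i
    · exact h.2
    · simp [f, logForm, h.1 i]
  have h1 := finrank_span_eq_card hind
  rw [Fintype.card_option] at h1
  rw [← h1]
  have : Module.Finite L (Submodule.span L (Set.range fun k => evalDerivation C (z k))) :=
    Module.Finite.span_of_finite L (Set.finite_range _)
  exact (Submodule.finrank_mono hspan).trans (finrank_range_le_card _)

end Ax

/-! ### Isolating one exponential by a differential operator -/

section Operators

variable {C L : Type*} [Field C] [Field L] [Algebra C L] {ι : Type*} [Fintype ι]

/-- Exponential shift: T − μ acts on P(x)w by differentiating P. -/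
theorem aeval_sub_pow_apply (T : Derivation C L L) {x w : L} (hx : T x = 1) {μ : C}
    (hw : T w = algebraMap C L μ * w) (P : C[X]) (s : ℕ) :
    aeval (T : Module.End C L) ((X - Polynomial.C μ) ^ s) (aeval x P * w) =
      aeval x (derivative^[s] P) * w := by
  induction s generalizing P with
  | zero => simp
  | succ s ih =>
    rw [pow_succ, map_mul (aeval (T : Module.End C L)), Module.End.mul_apply, Function.iterate_succ_apply, ← ih]
    congr 1
    simp only [map_sub, aeval_X, aeval_C, LinearMap.sub_apply, Derivation.coeFn_coe,
      Module.algebraMap_end_apply, Derivation.leibniz, T.map_aeval, hx, hw, smul_eq_mul,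
      Algebra.smul_def]
    ring

/-- With r = deg P at `i₀`, (T − μ)ʳ reduces that block to a constant multiple of w. The factors at
the other roots kill the other blocks and only rescale this one. -/
theorem exists_aeval_apply_eq_smul [CharZero C] (T : Derivation C L L) {x : L} (hx : T x = 1)
    {μ : ι → C} (hμ : Function.Injective μ) (w : ι → L) (hw0 : ∀ i, w i ≠ 0)
    (hw : ∀ i, T (w i) = algebraMap C L (μ i) * w i) (ν : ι → ℕ) (P : ι → C[X])
    (hP : ∀ i, (P i).degree < ν i) (i₀ : ι) (hi₀ : P i₀ ≠ 0) :
    ∃ (q : C[X]) (c : C), q.natDegree < ∑ i, ν i ∧ c ≠ 0 ∧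
      aeval (T : Module.End C L) q (∑ i, aeval x (P i) * w i) = c • w i₀ := by
  classical
  set r := (P i₀).natDegree with hr
  have hrν : r < ν i₀ := (natDegree_lt_iff_degree_lt hi₀).mpr (hP i₀)
  let Q : C[X] := ∏ i ∈ Finset.univ.erase i₀, (X - Polynomial.C (μ i)) ^ ν i
  have hQ : Q.Monic := monic_prod_of_monic _ _ fun i _ => (monic_X_sub_C _).pow _
  have hc : derivative^[r] (P i₀) = Polynomial.C ((r.factorial : C) * (P i₀).leadingCoeff) := by
    have h0 : (derivative^[r] (P i₀)).natDegree = 0 := by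
      have := natDegree_iterate_derivative (P i₀) r
      omega
    rw [eq_C_of_natDegree_eq_zero h0, coeff_iterate_derivative]
    simp [Nat.descFactorial_self, hr]
  refine ⟨Q * (X - Polynomial.C (μ i₀)) ^ r, Q.eval (μ i₀) * (r.factorial * (P i₀).leadingCoeff), ?_, ?_, ?_⟩
  · rw [hQ.natDegree_mul ((monic_X_sub_C _).pow _), natDegree_prod_of_monic _ _
      fun i _ => (monic_X_sub_C _).pow _, ← Finset.add_sum_erase _ ν (Finset.mem_univ i₀)]
    simp only [natDegree_pow, natDegree_X_sub_C, mul_one]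
    omega
  · refine mul_ne_zero ?_ (mul_ne_zero (by exact_mod_cast r.factorial_ne_zero)
      (leadingCoeff_ne_zero.mpr hi₀))
    rw [eval_prod, Finset.prod_ne_zero_iff]
    intro i hi
    simp only [eval_pow, eval_sub, eval_X, eval_C]
    exact pow_ne_zero _ (sub_ne_zero.mpr fun h => (Finset.mem_erase.mp hi).1 (hμ h.symm))
  · rw [map_sum, Finset.sum_eq_single i₀]
    · rw [map_mul (aeval (T : Module.End C L)), Module.End.mul_apply, aeval_sub_pow_apply T hx (hw i₀), hc, aeval_C,
        ← Algebra.smul_def, map_smul, mul_comm (Q.eval (μ i₀)),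
        mul_smul _ (Q.eval (μ i₀))]
      congr 1
      refine Module.End.aeval_apply_of_hasEigenvector ⟨?_, hw0 i₀⟩
      rw [Module.End.mem_eigenspace_iff, Algebra.smul_def]
      exact hw i₀
    · intro i _ hi
      obtain ⟨Q', hQ'⟩ := Finset.dvd_prod_of_mem (fun i => (X - Polynomial.C (μ i)) ^ ν i)
        (Finset.mem_erase.mpr ⟨hi, Finset.mem_univ i⟩)
      have : Q * (X - Polynomial.C (μ i₀)) ^ r = Q' * (X - Polynomial.C (μ i₀)) ^ r * (X - Polynomial.C (μ i)) ^ ν i := by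
        rw [show Q = _ from hQ']; ring
      rw [this, map_mul (aeval (T : Module.End C L)), Module.End.mul_apply, aeval_sub_pow_apply T hx (hw i)]
      have h0 : derivative^[ν i] (P i) = 0 := by
        by_cases hPi : P i = 0
        · simp [hPi]
        · exact iterate_derivative_eq_zero ((natDegree_lt_iff_degree_lt hPi).mpr (hP i))
      simp [h0]
    · simp

theorem derivation_block_eq_zero [CharZero C] (E T : Derivation C L L) {x : L} (hx : T x = 1)
    {μ : ι → C} (hμ : Function.Injective μ) (w : ι → L) (hw0 : ∀ i, w i ≠ 0)
    (hw : ∀ i, T (w i) = algebraMap C L (μ i) * w i) (ν : ι → ℕ) (P : ι → C[X])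
    (hP : ∀ i, (P i).degree < ν i) (i₀ : ι) (hi₀ : P i₀ ≠ 0)
    (hE : ∀ l < ∑ i, ν i, E (T^[l] (∑ i, aeval x (P i) * w i)) = 0) : E (w i₀) = 0 := by
  obtain ⟨q, c, hq, hc, h⟩ := exists_aeval_apply_eq_smul T hx hμ w hw0 hw ν P hP i₀ hi₀
  have h1 := congrArg E h
  rw [E.map_smul, aeval_eq_sum_range' hq, LinearMap.sum_apply, map_sum, Finset.sum_eq_zero] at h1
  · exact (smul_eq_zero.mp h1.symm).resolve_left hc
  · intro l hl
    rw [LinearMap.smul_apply, E.map_smul, Module.End.pow_apply]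
    exact smul_eq_zero_of_right _ (hE l (Finset.mem_range.mp hl))

/-- E kills C(z), hence is linear over it, and F is algebraic over C(z). Linearity over ℤ suffices
because the constants of K and of L may differ. -/
theorem derivation_comp_eq_zero_of_isTranscendenceBasis {C F L κ : Type*} [Field C] [Field F]
    [CharZero F] [Field L] [Algebra C F] [Algebra F L] {z : κ → F}
    (hz : IsTranscendenceBasis C z)
    (E : Derivation ℤ L L) (hC : ∀ c, E (algebraMap F L (algebraMap C F c)) = 0)
    (hE : ∀ k, E (algebraMap F L (z k)) = 0) (s : F) : E (algebraMap F L s) = 0 := by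
  let A := IntermediateField.adjoin C (Set.range z)
  have hA (a : F) (ha : a ∈ A) : E (algebraMap F L a) = 0 := by
    induction ha using IntermediateField.adjoin_induction with
    | mem a ha => obtain ⟨k, rfl⟩ := ha; exact hE k
    | algebraMap c => exact hC c
    | add a b _ _ ha hb => rw [map_add, map_add, ha, hb, add_zero]
    | mul a b _ _ ha hb => rw [map_mul, Derivation.leibniz, ha, hb, smul_zero, smul_zero, add_zero]
    | inv a _ ha => rw [map_inv₀, Derivation.leibniz_inv, ha, smul_zero]
  have := hz.isAlgebraic_field
  let E' : Derivation A L L := Derivation.mk'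
    { toFun := E
      map_add' := map_add E
      map_smul' := fun a b => by
        rw [Algebra.smul_def, IsScalarTower.algebraMap_apply A F L, Derivation.leibniz,
          show E (algebraMap F L (algebraMap A F a)) = 0 from hA a a.2]
        simp [Algebra.smul_def, IsScalarTower.algebraMap_apply A F L] }
    fun a b => E.leibniz a b
  exact derivation_eq_zero_of_isAlgebraic E'
    ((Algebra.IsAlgebraic.isAlgebraic (R := A) s).algebraMap)

end Operators

/-! ### Constants, base change and eigenvalues -/

section DifferentialFields

/-- The derivation of a differential field, as a derivation over the field of constants. -/
noncomputable def derivConstants (L : Type*) [Field L] [Differential L] :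
    Derivation (constants L) L L :=
  Derivation.mk'
    { toFun := fun a => Differential.deriv a
      map_add' := map_add _
      map_smul' := fun c a => by
        have hc : (c : L)′ = 0 := c.2
        simp [Algebra.smul_def, hc, show algebraMap (constants L) L c = c from rfl] }
    fun a b => Derivation.leibniz _ a b

theorem mem_constants {L : Type*} [Field L] [Differential L] {a : L} :
    a ∈ constants L ↔ a′ = 0 := Iff.rfl

theorem pd_apply {L : Type*} [Field L] [Differential L] (x a : L) : pd x a = (x′)⁻¹ * a′ := rfl

variable {K L : Type*} [Field K] [Field L] [Algebra K L]

section

variable [Differential K] [Differential L] [DifferentialAlgebra K L]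

theorem algebraMap_mem_constants {a : K} (ha : a ∈ constants K) :
    algebraMap K L a ∈ constants L := by
  rw [mem_constants] at ha ⊢
  rw [deriv_algebraMap, ha, map_zero]

theorem algebraMap_iterate_pd (x y : K) (l : ℕ) :
    algebraMap K L ((pd x)^[l] y) = (pd (algebraMap K L x))^[l] (algebraMap K L y) := by
  induction l with
  | zero => rfl
  | succ l ih =>
    rw [Function.iterate_succ_apply', Function.iterate_succ_apply', ← ih, pd_apply, pd_apply,
      deriv_algebraMap, deriv_algebraMap, map_mul, map_inv₀]

end

theorem degree_charPoly {n : ℕ} (c : Fin n → K) : (charPoly c).degree = n := by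
  rw [charPoly, degree_add_eq_left_of_degree_lt] <;> rw [degree_X_pow]
  exact degree_sum_fin_lt c

variable {n k : ℕ} {c : Fin n → K} {μ : Fin k → L} {ν : Fin k → ℕ}

theorem IsEigenvalues.sum_mult (h : IsEigenvalues c μ ν) : ∑ i, ν i = n := by
  have h1 := congrArg natDegree h.factor
  rw [natDegree_map, natDegree_eq_of_degree_eq_some (degree_charPoly c), natDegree_prod_of_monic _ _
      fun i _ => (monic_X_sub_C _).pow _] at h1
  simpa using h1.symm

theorem IsEigenvalues.eval_eq_zero (h : IsEigenvalues c μ ν) (i : Fin k) :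
    ((charPoly c).map (algebraMap K L)).eval (μ i) = 0 := by
  rw [h.factor, eval_prod]
  refine Finset.prod_eq_zero (Finset.mem_univ i) ?_
  simp [(h.mult_pos i).ne']

theorem IsEigenvalues.ne_zero (h : IsEigenvalues c μ ν) (hn : 0 < n) (hc0 : c ⟨0, hn⟩ ≠ 0)
    (i : Fin k) : μ i ≠ 0 := by
  intro h0
  have h1 := h.eval_eq_zero i
  rw [h0, ← coeff_zero_eq_eval_zero, coeff_map, charPoly, coeff_add, finsetSum_coeff,
    Finset.sum_eq_single ⟨0, hn⟩] at h1
  · simp [coeff_X_pow, hn.ne, hc0] at h1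
  · intro j _ hj
    have : (j : ℕ) ≠ 0 := fun h => hj (Fin.ext h)
    simp [coeff_X_pow, this.symm]
  · simp

theorem IsEigenvalues.mem_constants [CharZero L] [Differential K] [Differential L]
    [DifferentialAlgebra K L] (h : IsEigenvalues c μ ν)
    (hc : ∀ i, c i ∈ constants K) (i : Fin k) : μ i ∈ constants L := by
  -- The eigenvalues are algebraic over the constants, as roots of the characteristic polynomial
  -- read there.
  let p : (constants L)[X] :=
    charPoly fun i => (⟨algebraMap K L (c i), algebraMap_mem_constants (hc i)⟩ : constants L)
  have hp : p.map (algebraMap (constants L) L) = (charPoly c).map (algebraMap K L) := by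
    simp only [p, charPoly, Polynomial.map_add, Polynomial.map_sum, Polynomial.map_mul,
      Polynomial.map_pow, map_X, map_C]
    rfl
  refine ConstCoeffLDE.mem_constants.mpr <| derivation_eq_zero_of_isAlgebraic (derivConstants L) ⟨p, ?_, ?_⟩
  · intro h0
    have h1 : (charPoly c).map (algebraMap K L) = 0 := by rw [← hp, h0, Polynomial.map_zero]
    rw [Polynomial.map_eq_zero] at h1
    simpa [h1] using degree_charPoly c
  · rw [aeval_def, ← eval_map, hp, h.eval_eq_zero]

end DifferentialFields

/-! ### Canonical systems -/

section Application

variable {L : Type*} [Field L] [CharZero L] [Differential L] {k : ℕ} {μ : Fin k → L}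
  {ν : Fin k → ℕ}

theorem derivation_eq_zero_of_canonicalSystem (hμ : Function.Injective μ)
    (hμc : ∀ i, μ i ∈ constants L) {x y : L} (hx : x′ ≠ 0) {w : Fin k → L}
    (hw : ∀ i, w i ≠ 0 ∧ pd x (w i) = μ i * w i)
    {a b : (Σ i : Fin k, Fin (ν i)) → L} (ha : ∀ s, a s ∈ constants L ∧ a s ≠ 0)
    (hb : ∀ s, b s ∈ constants L) (hy : y = ∑ s, b s * (a s * x ^ (s.2 : ℕ) * w s.1))
    {i : Fin k} (hi : ∃ j : Fin (ν i), b ⟨i, j⟩ ≠ 0)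
    (E : Derivation (constants L) L L)
    (hE : ∀ l < ∑ i, ν i, E ((pd x)^[l] y) = 0) : E (w i) = 0 := by
  let T : Derivation (constants L) L L := (x′)⁻¹ • derivConstants L
  have hT : ⇑T = ⇑(pd x) := rfl
  -- Block i of y is Pᵢ(x)wᵢ, with deg Pᵢ < νᵢ.
  let P (i : Fin k) : (constants L)[X] := ∑ j : Fin (ν i),
    Polynomial.C (⟨b ⟨i, j⟩ * a ⟨i, j⟩, (constants L).mul_mem (hb _) (ha _).1⟩ : constants L) *
      X ^ (j : ℕ)
  have hy' : y = ∑ i, aeval x (P i) * w i := by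
    rw [hy, Fintype.sum_sigma]
    refine Finset.sum_congr rfl fun i _ => ?_
    simp only [P, map_sum, map_mul, map_pow, aeval_C, aeval_X, Finset.sum_mul]
    refine Finset.sum_congr rfl fun j _ => ?_
    rw [show algebraMap (constants L) L ⟨b ⟨i, j⟩ * a ⟨i, j⟩, _⟩ = b ⟨i, j⟩ * a ⟨i, j⟩ from rfl]
    ring
  have hPi : P i ≠ 0 := by
    obtain ⟨j, hj⟩ := hi
    intro h0
    have h1 := congrArg (fun p => coeff p j) h0
    simp only [P, finsetSum_coeff, coeff_C_mul, coeff_X_pow, coeff_zero] at h1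
    rw [Finset.sum_eq_single j (fun j' _ hj' => by
      rw [if_neg fun h => hj' (Fin.ext h.symm), mul_zero]) (by simp), if_pos rfl, mul_one] at h1
    exact mul_ne_zero hj (ha _).2 (congrArg Subtype.val h1)
  refine derivation_block_eq_zero E T (x := x) (μ := fun i => ⟨μ i, hμc i⟩)
    ?_ (fun i j h => hμ (congrArg Subtype.val h)) w (fun i => (hw i).1) (fun i => (hw i).2) ν P
    (fun i => degree_sum_fin_lt _) i hPi (by rwa [hT, ← hy'])
  rw [hT, pd_apply, inv_mul_cancel₀ hx]

end Application

end ConstCoeffLDE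

/-! ### The main inequality -/

open ConstCoeffLDE in
theorem theorem6p4
    {K : Type*} [Field K] [CharZero K] [Differential K]
    {L : Type*} [Field L] [CharZero L] [Differential L] [Algebra K L] [DifferentialAlgebra K L]
    {n : ℕ} (hn : 0 < n) (c : Fin n → K) (hc : ∀ i, c i ∈ ConstCoeffLDE.constants K)
    (hc0 : c ⟨0, hn⟩ ≠ 0)
    {k : ℕ} (μ : Fin k → L) (ν : Fin k → ℕ) (hμ : ConstCoeffLDE.IsEigenvalues c μ ν)
    {m : ℕ} (hm : 0 < m) (x y : Fin m → K)
    (hx : ∀ j, x j ∉ ConstCoeffLDE.constants K)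
    (hxy : ∀ j, ConstCoeffLDE.Delta c (x j) (y j) = 0)
    (v : Fin m → (Σ i : Fin k, Fin (ν i)) → L)
    (hv : ∀ j, ConstCoeffLDE.IsCanonicalSystem μ ν (algebraMap K L (x j)) (v j)) :
    ((ConstCoeffLDE.ldim (fun q : Fin m × Fin k =>
        (ConstCoeffLDE.eps (v q.1) (algebraMap K L (y q.1)) q.2 : L) * μ q.2 *
          algebraMap K L (x q.1)) : ℕ) : Cardinal) + 1
      ≤ ConstCoeffLDE.td
          (Set.range x ∪ {z : K | ∃ (j : Fin m) (l : ℕ), l < n ∧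
            z = (ConstCoeffLDE.pd (x j))^[l] (y j)}) := by
  set S : Set K := Set.range x ∪ {z : K | ∃ (j : Fin m) (l : ℕ), l < n ∧
    z = (pd (x j))^[l] (y j)}
  let F := IntermediateField.adjoin (constants K) S
  have : FaithfulSMul (constants K) F :=
    (faithfulSMul_iff_algebraMap_injective _ _).mpr (algebraMap (constants K) F).injective
  obtain ⟨κ, z, hz⟩ := exists_isTranscendenceBasis' (constants K) F
  rw [td, ← hz.cardinalMk_eq_trdeg]
  rcases finite_or_infinite κ with hκ | hκ
  swap
  · exact_mod_cast (Cardinal.natCast_lt_aleph0 (n := _ + 1)).le.trans (Cardinal.aleph0_le_mk κ)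
  have := Fintype.ofFinite κ
  rw [Cardinal.mk_fintype, ← Nat.cast_add_one, Nat.cast_le]
  choose w a hw ha hwa using hv
  have hμc := hμ.mem_constants hc
  have hμ0 := hμ.ne_zero hn hc0
  have hx' (j) : (algebraMap K L (x j))′ ≠ 0 := by
    rw [deriv_algebraMap, _root_.map_ne_zero]
    exact hx j
  set f : Fin m × Fin k → L := fun q => (eps (v q.1) (algebraMap K L (y q.1)) q.2 : L) * μ q.2 *
    algebraMap K L (x q.1) with hf
  -- `g` selects the pairs (j, i) whose entries form a ℚ-basis of the span modulo constants.
  obtain ⟨ι, g, hg, hspan, hli⟩ := exists_linearIndependent' ℚ fun q => (constantsQ L).mkQ (f q)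
  have : Finite ι := Finite.of_injective g hg
  have := Fintype.ofFinite ι
  have hdim : ldim f = Fintype.card ι := by
    rw [ldim, ← hspan, finrank_span_eq_card hli]
  -- A basis vector is nonzero, so ε = 1 at every selected pair.
  have hrep (o : ι) : ∃ b : (Σ i : Fin k, Fin (ν i)) → L, (∀ s, b s ∈ constants L) ∧
      algebraMap K L (y (g o).1) = ∑ s, b s * v (g o).1 s ∧ ∃ j, b ⟨(g o).2, j⟩ ≠ 0 := by
    by_contra h
    refine hli.ne_zero o ?_
    have h0 : eps (v (g o).1) (algebraMap K L (y (g o).1)) (g o).2 = 0 := if_neg h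
    simp [hf, h0]
  have hfu (o : ι) : f (g o) = μ (g o).2 * algebraMap K L (x (g o).1) := by
    have h1 : eps (v (g o).1) (algebraMap K L (y (g o).1)) (g o).2 = 1 := if_pos (hrep o)
    simp [hf, h1]
  rw [hdim]
  refine card_add_one_le_of_exponential (derivConstants L) (fun a ha => ⟨⟨a, ha⟩, rfl⟩)
    (fun o => f (g o)) (fun o => w (g o).1 (g o).2) (fun o => (hw _ _).1) (fun o => ?_)
    (fun r hr => ?_) (hx' ⟨0, hm⟩) (fun i => algebraMap K L (z i)) (fun E hE => ?_)
  · have h1 := (hw (g o).1 (g o).2).2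
    rw [pd_apply, inv_mul_eq_iff_eq_mul₀ (hx' _)] at h1
    have hμo : (μ (g o).2)′ = 0 := hμc _
    change (w (g o).1 (g o).2)′ = (f (g o))′ * _
    rw [h1, hfu, Derivation.leibniz, hμo]
    simp only [smul_eq_mul]
    ring
  · have hmem : ∑ o, r o * f (g o) ∈ constantsQ L := hr
    rw [← Submodule.Quotient.mk_eq_zero, ← Submodule.mkQ_apply, map_sum] at hmem
    have h0 := Fintype.linearIndependent_iff.mp hli (fun o => (r o : ℚ)) (by
      rw [← hmem]
      refine Finset.sum_congr rfl fun o _ => ?_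
      rw [Function.comp_apply, ← map_smul, Rat.smul_def, Rat.cast_intCast])
    funext o
    exact_mod_cast h0 o
  · have hF (s : K) (hs : s ∈ S) : E (algebraMap K L s) = 0 :=
      derivation_comp_eq_zero_of_isTranscendenceBasis hz (E.restrictScalars ℤ)
        (fun c => E.map_algebraMap ⟨algebraMap K L c, algebraMap_mem_constants c.2⟩)
        hE ⟨s, IntermediateField.subset_adjoin _ _ hs⟩
    have hEx (j) : E (algebraMap K L (x j)) = 0 := hF _ (Or.inl ⟨j, rfl⟩)
    refine ⟨fun o => ⟨?_, ?_⟩, hEx _⟩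
    · rw [hfu, Derivation.leibniz, hEx, smul_zero, zero_add]
      exact smul_eq_zero_of_right _ (E.map_algebraMap ⟨μ (g o).2, hμc _⟩)
    · obtain ⟨b, hb, hy, hj⟩ := hrep o
      simp_rw [hwa] at hy
      refine derivation_eq_zero_of_canonicalSystem hμ.injective hμc (hx' _) (hw _) (ha _) hb hy hj
        E fun l hl => ?_
      rw [← algebraMap_iterate_pd]
      exact hF _ (Or.inr ⟨_, l, hμ.sum_mult ▸ hl, rfl⟩)
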